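/- Let $(B_t)_{t\ge 0}$ be a standard Brownian motion (with $B_0=0$), and for integers $n\ge 1$ let $$\hat L_n=\int_1^n \frac{B_t^2}{t^2}\,dt ,\qquad K(c)=\frac{(1-c)^2}{8c}\quad (c>0).$$ Then the following hold. 1. For every fixed $c\in(0,1]$, $\;\mathbb P(\hat L_n\le c\ln n)=n^{-K(c)+o(1)}$ as $n\to\infty$. 2. For every fixed $c\in[1,\infty)$, $\;\mathbb P(\hat L_n\ge c\ln n)=n^{-K(c)+o(1)}$ as $n\to\infty$. -/

import Mathlib

open MeasureTheory ProbabilityTheory Filter Topology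
open scoped NNReal

/-- The functional `∫_1^n B_t² / t² dt` of a real process `B` indexed by `[0, ∞)`, at the sample
point `ω`. (On `[1, n]` the variable `t` is positive, so `t.toNNReal` is just `t`.) -/
noncomputable def brownianL {Ω : Type*} (B : ℝ≥0 → Ω → ℝ) (n : ℕ) (ω : Ω) : ℝ :=
  ∫ t in (1 : ℝ)..(n : ℝ), (B t.toNNReal ω) ^ 2 / t ^ 2

/-- The rate function `K(c) = (1 - c)² / (8 c)`, used for `c > 0`. -/
noncomputable def rateK (c : ℝ) : ℝ := (1 - c) ^ 2 / (8 * c)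

/-! ### Gaussian integrals of exponentials of squares, and the Riccati recursion. -/

section

/-! Write `L_n` for the functional and `λ = β(1 - 2β)`. By Itô's formula `t^(-β) exp(β B_t²/t + λ ∫
B²/t²)` has no drift, which suggests `E exp(λ L_n) ≍ n^β` for every `β < 1/4`. The proof is a
discrete version of this that avoids stochastic calculus. On a geometric grid, integrating out one
Gaussian increment at a time gives exact exponential moments through a Riccati recursion
(`IsPreBrownianReal.lintegral_exp_sum_sq`). A constant solution leaves a terminal term `β B²/t`,
which is dropped for the bound its sign permits; the opposite bound uses a solution vanishing at the
last time. Refining the grid yields `IsBrownianReal.exists_mgf_brownianL_bounds`.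

What remains is a large deviation argument at speed `log n`. As a function of `λ`, the growth rate
`β` has slope `1/(1 - 4β)`, so slope `c` occurs at `β = (1 - 1/c)/4`, and the Legendre transform at
`c` is `K(c)`. Chernoff's inequality gives the upper bounds. For the lower bounds, the exponential
moment tilted to a value near `c` is carried by a small window (`mgf_le_measureReal_add`,
`IsBrownianReal.eventually_le_measureReal_Icc`), which is placed on the required side of `c`. -/

theorem lintegral_exp_mul_add_sq_gaussianReal (v : ℝ≥0) (c y : ℝ) (h : 2 * c * v < 1) :
    ∫⁻ z, ENNReal.ofReal (Real.exp (c * (y + z) ^ 2)) ∂gaussianReal 0 v =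
      ENNReal.ofReal ((√(1 - 2 * c * v))⁻¹) *
        ENNReal.ofReal (Real.exp (c / (1 - 2 * c * v) * y ^ 2)) := by
  rcases eq_or_ne v 0 with rfl | hv
  · simp
  have hd : 0 < 1 - 2 * c * v := by linarith
  have hd' : 1 - 2 * v * c ≠ 0 := by linarith
  have hv0 : (0 : ℝ) < v := by positivity
  obtain ⟨w, hw⟩ : ∃ w : ℝ≥0, (w : ℝ) = v / (1 - 2 * c * v) :=
    ⟨⟨v / (1 - 2 * c * v), by positivity⟩, rfl⟩
  have hw0 : w ≠ 0 := by
    intro h0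
    rw [h0] at hw
    have : (0 : ℝ) < v / (1 - 2 * c * v) := by positivity
    exact this.ne hw
  rw [gaussianReal_of_var_ne_zero _ hv,
    lintegral_withDensity_eq_lintegral_mul _ (measurable_gaussianPDF _ _) (by fun_prop)]
  -- Completing the square: the weighted density is a multiple of a Gaussian density of variance `v
  -- / (1 - 2cv)`.
  have key : ∀ z, (gaussianPDF 0 v * fun z ↦ ENNReal.ofReal (Real.exp (c * (y + z) ^ 2))) z =
      ENNReal.ofReal ((√(1 - 2 * c * v))⁻¹) *
        ENNReal.ofReal (Real.exp (c / (1 - 2 * c * v) * y ^ 2)) *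
          gaussianPDF (2 * c * y * w) w z := by
    intro z
    simp only [Pi.mul_apply, gaussianPDF, gaussianPDFReal]
    rw [← ENNReal.ofReal_mul (by positivity), ← ENNReal.ofReal_mul (by positivity),
      ← ENNReal.ofReal_mul (by positivity)]
    congr 1
    have h1 : (√(2 * Real.pi * v))⁻¹ = (√(1 - 2 * c * v))⁻¹ * (√(2 * Real.pi * w))⁻¹ := by
      rw [← mul_inv, ← Real.sqrt_mul hd.le, hw]
      congr 2
      field_simp
    have h2 : -(z - 0) ^ 2 / (2 * v) + c * (y + z) ^ 2 =
        c / (1 - 2 * c * v) * y ^ 2 + -(z - 2 * c * y * w) ^ 2 / (2 * w) := by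
      rw [hw]
      field_simp
      ring_nf
    rw [h1, mul_assoc, mul_assoc, mul_assoc, mul_assoc, ← Real.exp_add, h2, Real.exp_add]
    ac_rfl
  simp_rw [key]
  rw [lintegral_const_mul _ (measurable_gaussianPDF _ _), lintegral_gaussianPDF_eq_one _ hw0, mul_one]

variable {Ω : Type*} [MeasurableSpace Ω] {P : Measure Ω} {B : ℝ≥0 → Ω → ℝ}

theorem lintegral_exp_add_mul_add_sq_of_indepFun [IsProbabilityMeasure P] {S Y Z : Ω → ℝ}
    {v : ℝ≥0} (hS : AEMeasurable S P) (hY : AEMeasurable Y P) (hZ : HasLaw Z (gaussianReal 0 v) P)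
    (hind : IndepFun (fun ω ↦ (S ω, Y ω)) Z P) (c : ℝ) (h : 2 * c * v < 1) :
    ∫⁻ ω, ENNReal.ofReal (Real.exp (S ω + c * (Y ω + Z ω) ^ 2)) ∂P =
      ENNReal.ofReal ((√(1 - 2 * c * v))⁻¹) *
        ∫⁻ ω, ENNReal.ofReal (Real.exp (S ω + c / (1 - 2 * c * v) * Y ω ^ 2)) ∂P := by
  have hSY : AEMeasurable (fun ω ↦ (S ω, Y ω)) P := hS.prodMk hY
  have hmap := (indepFun_iff_map_prod_eq_prod_map_map hSY hZ.aemeasurable).1 hind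
  have e1 : ∫⁻ ω, ENNReal.ofReal (Real.exp (S ω + c * (Y ω + Z ω) ^ 2)) ∂P =
      ∫⁻ p : (ℝ × ℝ) × ℝ, ENNReal.ofReal (Real.exp (p.1.1 + c * (p.1.2 + p.2) ^ 2))
        ∂(P.map (fun ω ↦ ((S ω, Y ω), Z ω))) := by
    rw [lintegral_map' (by fun_prop) (hSY.prodMk hZ.aemeasurable)]
  have e2 : ∫⁻ ω, ENNReal.ofReal (Real.exp (S ω + c / (1 - 2 * c * v) * Y ω ^ 2)) ∂P =
      ∫⁻ p : ℝ × ℝ, ENNReal.ofReal (Real.exp (p.1 + c / (1 - 2 * c * v) * p.2 ^ 2))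
        ∂(P.map (fun ω ↦ (S ω, Y ω))) := by
    rw [lintegral_map' (by fun_prop) hSY]
  have := Measure.isProbabilityMeasure_map hZ.aemeasurable
  rw [e1, e2, hmap, lintegral_prod _ (by fun_prop), hZ.map_eq,
    ← lintegral_const_mul _ (by fun_prop)]
  congr 1 with p
  simp_rw [Real.exp_add, ENNReal.ofReal_mul (Real.exp_nonneg _)]
  rw [lintegral_const_mul _ (by fun_prop), lintegral_exp_mul_add_sq_gaussianReal v c p.2 h]
  ring

/-- The expectation of the exponential of a diagonal quadratic form in the values of a Brownian
motion at finitely many times, the form being given through its Riccati recursion. -/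
theorem ProbabilityTheory.IsPreBrownianReal.lintegral_exp_sum_sq (hB : IsPreBrownianReal B P)
    {t : ℕ → ℝ≥0} (ht : Monotone t) (c : ℕ → ℝ) (h0 : 2 * c 0 * t 0 < 1) (N : ℕ)
    (hc : ∀ k < N, 2 * c (k + 1) * (t (k + 1) - t k) < 1) :
    ∫⁻ ω, ENNReal.ofReal (Real.exp (∑ k ∈ Finset.range N,
        (c k - c (k + 1) / (1 - 2 * c (k + 1) * (t (k + 1) - t k))) * B (t k) ω ^ 2
          + c N * B (t N) ω ^ 2)) ∂P =
      ENNReal.ofReal ((√(1 - 2 * c 0 * t 0))⁻¹ *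
        ∏ k ∈ Finset.range N, (√(1 - 2 * c (k + 1) * (t (k + 1) - t k)))⁻¹) := by
  have := hB.isGaussianProcess.isProbabilityMeasure
  induction N with
  | zero =>
    have h := lintegral_exp_mul_add_sq_gaussianReal (t 0) (c 0) 0 h0
    rw [← (hB.hasLaw_eval (t 0)).map_eq,
      lintegral_map' (by fun_prop) (hB.aemeasurable _)] at h
    simpa using h
  | succ N ih =>
    have hle : t N ≤ t (N + 1) := ht N.le_succ
    set S : Ω → ℝ := fun ω ↦ ∑ k ∈ Finset.range (N + 1),
        (c k - c (k + 1) / (1 - 2 * c (k + 1) * (t (k + 1) - t k))) * B (t k) ω ^ 2 with hS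
    have hSm : AEMeasurable S P := by
      refine Finset.aemeasurable_fun_sum _ fun k _ ↦ ?_
      exact ((hB.aemeasurable _).pow_const 2).const_mul _
    have hd : ((t (N + 1) - t N : ℝ≥0) : ℝ) = t (N + 1) - t N := NNReal.coe_sub hle
    have hZ : HasLaw (fun ω ↦ B (t (N + 1)) ω - B (t N) ω)
        (gaussianReal 0 (t (N + 1) - t N)) P := by
      have := (hB.shift (t N)).hasLaw_eval (t (N + 1) - t N)
      rwa [add_tsub_cancel_of_le hle] at this
    have hind : IndepFun (fun ω ↦ (S ω, B (t N) ω)) (fun ω ↦ B (t (N + 1)) ω - B (t N) ω) P := by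
      have h := (hB.indepFun_shift (t N)).symm
      have hmem : ∀ k ∈ Finset.range (N + 1), t k ∈ Set.Iic (t N) := fun k hk ↦
        ht (Nat.lt_succ_iff.1 (Finset.mem_range.1 hk))
      have hφ : Measurable fun x : Set.Iic (t N) → ℝ ↦
          (∑ k ∈ (Finset.range (N + 1)).attach,
            (c k - c (k + 1) / (1 - 2 * c (k + 1) * (t (k + 1) - t k))) * x ⟨t k, hmem k k.2⟩ ^ 2,
            x ⟨t N, Set.mem_Iic.2 le_rfl⟩) :=
        Measurable.prodMk (Finset.measurable_sum _ fun k _ ↦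
          ((measurable_pi_apply _).pow_const 2).const_mul _) (measurable_pi_apply _)
      have hψ : Measurable fun y : ℝ≥0 → ℝ ↦ y (t (N + 1) - t N) := measurable_pi_apply _
      have h' := h.comp hφ hψ
      convert h' using 1
      · ext ω
        · simp only [hS, Function.comp]
          exact (Finset.sum_attach (Finset.range (N + 1)) (fun k ↦
            (c k - c (k + 1) / (1 - 2 * c (k + 1) * (t (k + 1) - t k))) * B (t k) ω ^ 2)).symm
        · rfl
      · ext ω
        simp [add_tsub_cancel_of_le hle]
    -- Integrating out the last increment turns the final square into `c (N + 1) / (1 - 2 c (N + 1)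
    -- Δ)` times `B (t N) ^ 2`. This cancels the subtracted part of the weight at `k = N`, leaving
    -- the coefficient `c N`.
    have hstep := lintegral_exp_add_mul_add_sq_of_indepFun hSm (hB.aemeasurable (t N)) hZ hind
      (c (N + 1)) (by rw [hd]; exact hc N N.lt_succ_self)
    simp only [add_sub_cancel, hd] at hstep
    rw [hstep, Finset.prod_range_succ, ← mul_assoc, ENNReal.ofReal_mul (by positivity),
      ← ih (fun k hk ↦ hc k (hk.trans N.lt_succ_self)), mul_comm]
    congr 2 with ω
    congr 2
    simp only [hS, Finset.sum_range_succ]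
    ring

end

/-! ### Exponential moments of the geometric Riemann sums. -/

section

/-- With the converse bound below, this turns products of `N` normalizing factors at `x = β s` into
`exp(β N s)` up to a correction that disappears with the mesh. Both are instances of `1 + y ≤ exp
y`. -/
theorem exp_le_inv_sqrt_one_sub {x : ℝ} (h : 2 * x < 1) : Real.exp x ≤ (√(1 - 2 * x))⁻¹ := by
  have hy : 0 < 1 - 2 * x := by linarith
  rw [le_inv_comm₀ (Real.exp_pos _) (Real.sqrt_pos.2 hy), ← Real.exp_neg]
  refine Real.sqrt_le_iff.2 ⟨(Real.exp_pos _).le, ?_⟩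
  rw [← Real.exp_nat_mul]
  have := Real.add_one_le_exp (-2 * x)
  push_cast
  rw [mul_neg, ← neg_mul]
  linarith

theorem inv_sqrt_one_sub_le_exp {x : ℝ} (h : 2 * x < 1) :
    (√(1 - 2 * x))⁻¹ ≤ Real.exp (x / (1 - 2 * x)) := by
  have hy : 0 < 1 - 2 * x := by linarith
  rw [inv_le_comm₀ (Real.sqrt_pos.2 hy) (Real.exp_pos _), ← Real.exp_neg]
  refine Real.le_sqrt_of_sq_le ?_
  rw [← Real.exp_nat_mul]
  have := Real.add_one_le_exp (2 * (x / (1 - 2 * x)))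
  have e : 2 * (x / (1 - 2 * x)) + 1 = (1 - 2 * x)⁻¹ := by field_simp; ring
  rw [e, inv_le_comm₀ hy (Real.exp_pos _), ← Real.exp_neg] at this
  simpa using this

/-- The left Riemann sum of `∫ B_t² / t² dt` along the geometric subdivision `1, q, …, q ^ N`. -/
noncomputable def geomSum {Ω : Type*} (B : ℝ≥0 → Ω → ℝ) (q : ℝ≥0) (N : ℕ) (ω : Ω) : ℝ :=
  (1 - (q : ℝ)⁻¹) * ∑ k ∈ Finset.range N, B (q ^ k) ω ^ 2 / (q : ℝ) ^ k

variable {Ω : Type*} {mΩ : MeasurableSpace Ω} {P : Measure Ω} {B : ℝ≥0 → Ω → ℝ} {q : ℝ≥0}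

theorem geomSum_nonneg (hq : 1 < q) (N : ℕ) (ω : Ω) : 0 ≤ geomSum B q N ω := by
  have h1 : (1 : ℝ) < q := by exact_mod_cast hq
  have : (q : ℝ)⁻¹ < 1 := inv_lt_one_of_one_lt₀ h1
  exact mul_nonneg (by linarith) (Finset.sum_nonneg fun k _ ↦ by positivity)

theorem ProbabilityTheory.IsPreBrownianReal.aemeasurable_geomSum (hB : IsPreBrownianReal B P) (q : ℝ≥0) (N : ℕ) :
    AEMeasurable (geomSum B q N) P :=
  (Finset.aemeasurable_fun_sum _ fun _ _ ↦
    ((hB.aemeasurable _).pow_const 2).div_const _).const_mul _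

/-- Brownian scaling: with coefficients `b k / q ^ k`, every step of the recursion involves the same
relative mesh `s`. -/
theorem ProbabilityTheory.IsPreBrownianReal.lintegral_exp_geom (hB : IsPreBrownianReal B P) (hq : 1 < q)
    {s : ℝ} (hs : s = 1 - (q : ℝ)⁻¹) (N : ℕ) (b : ℕ → ℝ) (h0 : 2 * b 0 < 1)
    (hb : ∀ k < N, 2 * (b (k + 1) * s) < 1) :
    ∫⁻ ω, ENNReal.ofReal (Real.exp (∑ k ∈ Finset.range N,
        (b k - b (k + 1) * (1 - s) / (1 - 2 * (b (k + 1) * s))) * (B (q ^ k) ω ^ 2 / (q : ℝ) ^ k)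
          + b N * (B (q ^ N) ω ^ 2 / (q : ℝ) ^ N))) ∂P =
      ENNReal.ofReal ((√(1 - 2 * b 0))⁻¹ *
        ∏ k ∈ Finset.range N, (√(1 - 2 * (b (k + 1) * s)))⁻¹) := by
  have h1 : (1 : ℝ) < q := by exact_mod_cast hq
  have hq0 : (q : ℝ) ≠ 0 := by positivity
  have e : ∀ k, 2 * (b (k + 1) / (q : ℝ) ^ (k + 1)) *
      (((q ^ (k + 1) : ℝ≥0) : ℝ) - ((q ^ k : ℝ≥0) : ℝ)) = 2 * (b (k + 1) * s) := by
    intro k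
    rw [hs]
    push_cast
    rw [pow_succ]
    field_simp
  have h := hB.lintegral_exp_sum_sq (t := fun k ↦ q ^ k) (pow_right_mono₀ hq.le)
    (fun k ↦ b k / (q : ℝ) ^ k) (by simpa using h0) N (fun k hk ↦ by rw [e]; exact hb k hk)
  simp only [e] at h
  convert h using 6
  · refine Finset.sum_congr rfl fun k _ ↦ ?_
    have e2 : b (k + 1) * (1 - s) / (1 - 2 * (b (k + 1) * s)) / (q : ℝ) ^ k =
        b (k + 1) / (q : ℝ) ^ (k + 1) / (1 - 2 * (b (k + 1) * s)) := by
      rw [hs, sub_sub_cancel, pow_succ, ← div_eq_mul_inv, div_div, div_div, div_div]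
      ring_nf
    rw [← e2]
    ring
  · ring
  · simp

section

variable {s β : ℝ}

theorem riccati_weight_const (h : 2 * (β * s) < 1) :
    β - β * (1 - s) / (1 - 2 * (β * s)) = β * (1 - 2 * β) / (1 - 2 * (β * s)) * s := by
  have : 1 - 2 * (β * s) ≠ 0 := by linarith
  rw [div_mul_eq_mul_div, eq_div_iff this, sub_mul, div_mul_cancel₀ _ this]
  ring

/-- The constant solution of the recursion, a discrete form of the driftless exponential. Dropping
the terminal square gives an upper bound if `β ≥ 0` and a lower bound if `β ≤ 0`. -/
theorem ProbabilityTheory.IsPreBrownianReal.lintegral_exp_geomSum_add (hB : IsPreBrownianReal B P) (hq : 1 < q)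
    (hs : s = 1 - (q : ℝ)⁻¹) (N : ℕ) (h0 : 2 * β < 1) (h : 2 * (β * s) < 1) :
    ∫⁻ ω, ENNReal.ofReal (Real.exp (β * (1 - 2 * β) / (1 - 2 * (β * s)) * geomSum B q N ω
          + β * (B (q ^ N) ω ^ 2 / (q : ℝ) ^ N))) ∂P =
      ENNReal.ofReal ((√(1 - 2 * β))⁻¹ * (√(1 - 2 * (β * s)))⁻¹ ^ N) := by
  have := hB.lintegral_exp_geom hq hs N (fun _ ↦ β) h0 (fun _ _ ↦ h)
  simp only [riccati_weight_const h, ← Finset.mul_sum, Finset.prod_const, Finset.card_range,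
    mul_assoc _ s] at this
  rw [← this]
  simp only [geomSum, hs]

theorem mesh_mem (hq : 1 < q) (hs : s = 1 - (q : ℝ)⁻¹) : 0 < s ∧ s < 1 := by
  have h1 : (1 : ℝ) < q := by exact_mod_cast hq
  have : (q : ℝ)⁻¹ < 1 := inv_lt_one_of_one_lt₀ h1
  have : 0 < (q : ℝ)⁻¹ := by positivity
  constructor <;> linarith

theorem ProbabilityTheory.IsPreBrownianReal.lintegral_exp_geomSum_le_of_nonneg (hB : IsPreBrownianReal B P)
    (hq : 1 < q) (hs : s = 1 - (q : ℝ)⁻¹) (N : ℕ) (hβ : 0 ≤ β) (hβ' : β < 1 / 4) :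
    ∫⁻ ω, ENNReal.ofReal (Real.exp (β * (1 - 2 * β) / (1 - 2 * (β * s)) * geomSum B q N ω)) ∂P ≤
      ENNReal.ofReal ((√(1 - 2 * β))⁻¹ * Real.exp (β / (1 - 2 * (β * s)) * (N * s))) := by
  obtain ⟨hs0, hs1⟩ := mesh_mem hq hs
  have h : 2 * (β * s) < 1 := by nlinarith
  calc _ ≤ _ := lintegral_mono fun ω ↦ ENNReal.ofReal_le_ofReal <| Real.exp_le_exp.2 <|
        le_add_of_nonneg_right (mul_nonneg hβ (by positivity))
    _ = _ := hB.lintegral_exp_geomSum_add hq hs N (by linarith) h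
    _ ≤ _ := by
      refine ENNReal.ofReal_le_ofReal (mul_le_mul_of_nonneg_left ?_ (by positivity))
      calc _ ≤ Real.exp (β * s / (1 - 2 * (β * s))) ^ N :=
            pow_le_pow_left₀ (by positivity) (inv_sqrt_one_sub_le_exp h) N
        _ = _ := by rw [← Real.exp_nat_mul]; congr 1; ring

theorem ProbabilityTheory.IsPreBrownianReal.le_lintegral_exp_geomSum_of_nonpos (hB : IsPreBrownianReal B P)
    (hq : 1 < q) (hs : s = 1 - (q : ℝ)⁻¹) (N : ℕ) (hβ : β ≤ 0) :
    ENNReal.ofReal ((√(1 - 2 * β))⁻¹ * Real.exp (β * (N * s))) ≤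
      ∫⁻ ω, ENNReal.ofReal (Real.exp
        (β * (1 - 2 * β) / (1 - 2 * (β * s)) * geomSum B q N ω)) ∂P := by
  obtain ⟨hs0, hs1⟩ := mesh_mem hq hs
  have h : 2 * (β * s) < 1 := by nlinarith
  calc _ ≤ ENNReal.ofReal ((√(1 - 2 * β))⁻¹ * (√(1 - 2 * (β * s)))⁻¹ ^ N) := by
        refine ENNReal.ofReal_le_ofReal (mul_le_mul_of_nonneg_left ?_ (by positivity))
        calc _ = Real.exp (β * s) ^ N := by rw [← Real.exp_nat_mul]; congr 1; ring
          _ ≤ _ := pow_le_pow_left₀ (by positivity) (exp_le_inv_sqrt_one_sub h) N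
    _ = _ := (hB.lintegral_exp_geomSum_add hq hs N (by linarith) h).symm
    _ ≤ _ := lintegral_mono fun ω ↦ ENNReal.ofReal_le_ofReal <| Real.exp_le_exp.2 <|
        add_le_of_nonpos_right (mul_nonpos_of_nonpos_of_nonneg hβ (by positivity))

theorem riccati_weight {κ θ : ℝ} (h : 2 * (β * θ * s) < 1) :
    β * (1 - (1 - κ * s) * (1 - θ)) - β * θ * (1 - s) / (1 - 2 * (β * θ * s)) =
      β * (κ * (1 - θ) + θ * (1 - 2 * (β * θ)) / (1 - 2 * (β * θ * s))) * s := by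
  have : 1 - 2 * (β * θ * s) ≠ 0 := by linarith
  rw [← mul_right_inj' this]
  simp only [mul_sub, mul_add, add_mul, mul_div_assoc', mul_left_comm _ β]
  field_simp
  ring

theorem sum_one_sub_pow {r : ℝ} (hr : r < 1) (hr0 : 0 ≤ r) (N : ℕ) :
    (N : ℝ) - (1 - r)⁻¹ ≤ ∑ k ∈ Finset.range N, (1 - r ^ (N - (k + 1))) := by
  have : ∑ k ∈ Finset.range N, r ^ (N - (k + 1)) = ∑ k ∈ Finset.range N, r ^ k := by
    rw [← Finset.sum_range_reflect (fun k ↦ r ^ k) N]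
    exact Finset.sum_congr rfl fun k _ ↦ by rw [Nat.sub_sub, add_comm 1 k]
  have h1 : 0 < 1 - r := by linarith
  have h2 : ∑ k ∈ Finset.range N, r ^ k ≤ (1 - r)⁻¹ := by
    rw [← one_div, le_div_iff₀ h1, mul_comm, mul_neg_geom_sum]
    linarith [pow_nonneg hr0 N]
  rw [Finset.sum_sub_distrib, this]
  simp only [Finset.sum_const, Finset.card_range, nsmul_eq_mul, mul_one]
  linarith

theorem geom_rec (r : ℝ) {k N : ℕ} (hk : k < N) :
    1 - r ^ (N - k) = 1 - r * (1 - (1 - r ^ (N - (k + 1)))) := by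
  have : N - k = N - (k + 1) + 1 := by omega
  rw [this, pow_succ]
  ring

/-- The coefficients `β (1 - r ^ (N - k))` vanish at `k = N`, so no terminal square remains. For `r
< 1` they approach `β` geometrically away from the end, so the total loss against the constant
solution is of order `s / (1 - r)`, bounded once `1 - r` is a fixed multiple of `s`. -/
theorem ProbabilityTheory.IsPreBrownianReal.lintegral_exp_geom_of_vanishing (hB : IsPreBrownianReal B P) (hq : 1 < q)
    (hs : s = 1 - (q : ℝ)⁻¹) (N : ℕ) {r : ℝ} (hr0 : 0 ≤ r) (hr1 : r ≤ 1) (hβ : β < 1 / 4) :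
    ∫⁻ ω, ENNReal.ofReal (Real.exp (∑ k ∈ Finset.range N,
        (β * (1 - r * (1 - (1 - r ^ (N - (k + 1))))) -
          β * (1 - r ^ (N - (k + 1))) * (1 - s) / (1 - 2 * (β * (1 - r ^ (N - (k + 1))) * s))) *
          (B (q ^ k) ω ^ 2 / (q : ℝ) ^ k))) ∂P =
      ENNReal.ofReal ((√(1 - 2 * (β * (1 - r ^ N))))⁻¹ *
        ∏ k ∈ Finset.range N, (√(1 - 2 * (β * (1 - r ^ (N - (k + 1))) * s)))⁻¹) := by
  obtain ⟨hs0, hs1⟩ := mesh_mem hq hs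
  have hθ : ∀ j, 0 ≤ 1 - r ^ j ∧ 1 - r ^ j ≤ 1 := fun j ↦
    ⟨by linarith [pow_le_one₀ hr0 hr1 (n := j)], by linarith [pow_nonneg hr0 j]⟩
  have hlt : ∀ j, 2 * (β * (1 - r ^ j)) < 1 := by
    intro j
    obtain ⟨h1, h2⟩ := hθ j
    nlinarith
  have := hB.lintegral_exp_geom hq hs N (fun k ↦ β * (1 - r ^ (N - k))) (hlt _)
    (fun k _ ↦ by nlinarith [hlt (N - (k + 1))])
  simp only [Nat.sub_self, pow_zero, sub_self, mul_zero, zero_mul, add_zero, Nat.sub_zero] at this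
  rw [← this]
  congr 1 with ω
  congr 2
  refine Finset.sum_congr rfl fun k hk ↦ ?_
  rw [geom_rec r (Finset.mem_range.1 hk)]


theorem ProbabilityTheory.IsPreBrownianReal.le_lintegral_exp_geomSum_of_nonneg
    (hB : IsPreBrownianReal B P) (hq : 1 < q) (hs : s = 1 - (q : ℝ)⁻¹) (N : ℕ) (hβ : 0 ≤ β)
    (hβ' : β < 1 / 4) :
    ENNReal.ofReal (Real.exp (β * (N * s) - β / (1 - 4 * β))) ≤
      ∫⁻ ω, ENNReal.ofReal (Real.exp
        (β * (1 - 2 * β) / (1 - 2 * (β * s)) * geomSum B q N ω)) ∂P := by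
  obtain ⟨hs0, hs1⟩ := mesh_mem hq hs
  have hκ : 0 < 1 - 4 * β := by linarith
  -- The rate `κ = 1 - 4β` comes from linearizing at `θ = 1`: then `κ(1 - θ) + θ(1 - 2βθ) = (1 - 2β)
  -- - 2β(1 - θ)²`, which is at most `1 - 2β`. It is positive exactly when `β < 1/4`.
  set r := 1 - (1 - 4 * β) * s with hr
  have hr0 : 0 ≤ r := by nlinarith
  have hr1 : r < 1 := by nlinarith
  have hθ : ∀ j, 0 ≤ 1 - r ^ j ∧ 1 - r ^ j ≤ 1 := fun j ↦
    ⟨by linarith [pow_le_one₀ hr0 hr1.le (n := j)], by linarith [pow_nonneg hr0 j]⟩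
  have hD : 0 < 1 - 2 * (β * s) := by nlinarith
  have hlt : ∀ j, β * (1 - r ^ j) * s ≤ β * s := by
    intro j
    rw [mul_right_comm]
    exact mul_le_of_le_one_right (by positivity) (hθ j).2
  calc _ ≤ _ := by
        refine ENNReal.ofReal_le_ofReal ?_
        have h1 : (1 : ℝ) ≤ (√(1 - 2 * (β * (1 - r ^ N))))⁻¹ := by
          have := exp_le_inv_sqrt_one_sub (x := β * (1 - r ^ N)) (by nlinarith [hθ N])
          exact (Real.one_le_exp (mul_nonneg hβ (hθ N).1)).trans this
        refine le_trans ?_ (le_mul_of_one_le_left (Finset.prod_nonneg fun _ _ ↦ by positivity) h1)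
        calc _ ≤ Real.exp (∑ k ∈ Finset.range N, β * (1 - r ^ (N - (k + 1))) * s) := by
              rw [Real.exp_le_exp, ← Finset.sum_mul, ← Finset.mul_sum]
              have h2 := mul_le_mul_of_nonneg_right (mul_le_mul_of_nonneg_left
                (sum_one_sub_pow hr1 hr0 N) hβ) hs0.le
              refine le_trans (le_of_eq ?_) h2
              rw [hr, sub_sub_cancel, mul_inv]
              field_simp
          _ = ∏ k ∈ Finset.range N, Real.exp (β * (1 - r ^ (N - (k + 1))) * s) := Real.exp_sum _ _
          _ ≤ _ := Finset.prod_le_prod (fun _ _ ↦ (Real.exp_pos _).le) fun k _ ↦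
              exp_le_inv_sqrt_one_sub (by linarith [hlt (N - (k + 1))])
    _ = _ := (hB.lintegral_exp_geom_of_vanishing hq hs N hr0 hr1.le hβ').symm
    _ ≤ _ := by
        refine lintegral_mono fun ω ↦ ENNReal.ofReal_le_ofReal <| Real.exp_le_exp.2 ?_
        rw [geomSum, ← hs, ← mul_assoc, Finset.mul_sum]
        refine Finset.sum_le_sum fun k _ ↦ mul_le_mul_of_nonneg_right ?_ (by positivity)
        have hl := hlt (N - (k + 1))
        obtain ⟨h1, h2⟩ := hθ (N - (k + 1))
        generalize 1 - r ^ (N - (k + 1)) = θ at *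
        have hD' : 0 < 1 - 2 * (β * θ * s) := by linarith
        rw [riccati_weight (by linarith), mul_div_assoc β]
        refine mul_le_mul_of_nonneg_right (mul_le_mul_of_nonneg_left ?_ hβ) hs0.le
        calc (1 - 4 * β) * (1 - θ) + θ * (1 - 2 * (β * θ)) / (1 - 2 * (β * θ * s))
            ≤ (1 - 4 * β) * (1 - θ) / (1 - 2 * (β * s)) +
                θ * (1 - 2 * (β * θ)) / (1 - 2 * (β * s)) := by
              refine add_le_add (le_div_self (mul_nonneg hκ.le (by linarith)) hD
                (by nlinarith)) ?_
              exact div_le_div_of_nonneg_left (mul_nonneg h1 (by nlinarith)) hD (by linarith)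
          _ ≤ _ := by
              rw [← add_div]
              refine div_le_div_of_nonneg_right ?_ hD.le
              nlinarith [mul_nonneg hβ (mul_nonneg (sub_nonneg.2 h2) (sub_nonneg.2 h2))]

theorem ProbabilityTheory.IsPreBrownianReal.lintegral_exp_geomSum_le_of_nonpos
    (hB : IsPreBrownianReal B P) (hq : 1 < q) (hs : s = 1 - (q : ℝ)⁻¹) (N : ℕ) (hβ : β ≤ 0) :
    ∫⁻ ω, ENNReal.ofReal (Real.exp (β * (1 - 2 * β) * geomSum B q N ω)) ∂P ≤
      ENNReal.ofReal (Real.exp (β / (1 - 2 * (β * s)) * (N * s - 1))) := by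
  obtain ⟨hs0, hs1⟩ := mesh_mem hq hs
  have hr0 : 0 ≤ 1 - s := by linarith
  have hr1 : 1 - s < 1 := by linarith
  have hθ : ∀ j, 0 ≤ 1 - (1 - s) ^ j ∧ 1 - (1 - s) ^ j ≤ 1 := fun j ↦
    ⟨by linarith [pow_le_one₀ hr0 hr1.le (n := j)], by linarith [pow_nonneg hr0 j]⟩
  have hβs : β * s ≤ 0 := mul_nonpos_of_nonpos_of_nonneg hβ hs0.le
  have hD : 0 < 1 - 2 * (β * s) := by linarith
  have hlt : ∀ j, β * s ≤ β * (1 - (1 - s) ^ j) * s ∧ β * (1 - (1 - s) ^ j) * s ≤ 0 := by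
    intro j
    obtain ⟨h1, h2⟩ := hθ j
    rw [mul_right_comm]
    constructor <;> nlinarith
  calc _ ≤ _ := by
        refine lintegral_mono fun ω ↦ ENNReal.ofReal_le_ofReal <| Real.exp_le_exp.2 ?_
        rw [geomSum, ← hs, ← mul_assoc, Finset.mul_sum]
        refine Finset.sum_le_sum fun k _ ↦ mul_le_mul_of_nonneg_right ?_ (by positivity)
        obtain ⟨-, hl⟩ := hlt (N - (k + 1))
        obtain ⟨h1, h2⟩ := hθ (N - (k + 1))
        generalize 1 - (1 - s) ^ (N - (k + 1)) = θ at *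
        have hβθ : β * θ ≤ 0 := mul_nonpos_of_nonpos_of_nonneg hβ h1
        -- For `β ≤ 0` the rate `κ = 1` suffices, because `(1 - θ) + θ(1 - 2βθ) = 1 - 2βθ² ≤ 1 -
        -- 2β`.
        have e : 1 - s = 1 - 1 * s := by ring
        nth_rewrite 1 [e]
        rw [riccati_weight (by linarith)]
        refine mul_le_mul_of_nonneg_right (mul_le_mul_of_nonpos_left ?_ hβ) hs0.le
        have : θ * (1 - 2 * (β * θ)) / (1 - 2 * (β * θ * s)) ≤ θ * (1 - 2 * (β * θ)) :=
          div_le_self (mul_nonneg h1 (by linarith)) (by linarith)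
        nlinarith [mul_nonneg (neg_nonneg.2 hβ) (sub_nonneg.2 (mul_le_one₀ h2 h1 h2))]
    _ = _ := hB.lintegral_exp_geom_of_vanishing hq hs N hr0 hr1.le (by linarith)
    _ ≤ _ := by
        refine ENNReal.ofReal_le_ofReal ?_
        have h1 : (√(1 - 2 * (β * (1 - (1 - s) ^ N))))⁻¹ ≤ 1 := by
          refine inv_le_one_of_one_le₀ (Real.one_le_sqrt.2 ?_)
          nlinarith [hθ N]
        refine le_trans (mul_le_of_le_one_left (Finset.prod_nonneg fun _ _ ↦ by positivity) h1) ?_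
        calc _ ≤ ∏ k ∈ Finset.range N,
                Real.exp (β / (1 - 2 * (β * s)) * (1 - (1 - s) ^ (N - (k + 1))) * s) := by
              refine Finset.prod_le_prod (fun _ _ ↦ by positivity) fun k _ ↦ ?_
              obtain ⟨h3, h4⟩ := hlt (N - (k + 1))
              refine (inv_sqrt_one_sub_le_exp (by linarith)).trans (Real.exp_le_exp.2 ?_)
              rw [div_mul_eq_mul_div, div_mul_eq_mul_div]
              rw [div_le_div_iff₀ (by linarith) hD]
              exact mul_le_mul_of_nonpos_left (by linarith) h4
          _ = Real.exp (∑ k ∈ Finset.range N,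
                β / (1 - 2 * (β * s)) * (1 - (1 - s) ^ (N - (k + 1))) * s) :=
              (Real.exp_sum _ _).symm
          _ ≤ _ := by
              rw [Real.exp_le_exp, ← Finset.sum_mul, ← Finset.mul_sum, mul_assoc]
              refine mul_le_mul_of_nonpos_left ?_ (div_nonpos_of_nonpos_of_nonneg hβ hD.le)
              have h2 := mul_le_mul_of_nonneg_right (sum_one_sub_pow hr1 hr0 N) hs0.le
              refine le_trans (le_of_eq ?_) h2
              rw [sub_sub_cancel]
              field_simp

end

end

/-! ### From the geometric grid to the integral. -/

section

/-- The ratio `n ^ (1 / N)` of the geometric subdivision of `[1, n]` into `N` intervals. -/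
noncomputable def meshRatio (n N : ℕ) : ℝ≥0 := (n : ℝ≥0) ^ ((N : ℝ)⁻¹)

section Mesh

variable {n N : ℕ}

theorem one_lt_meshRatio (hn : 2 ≤ n) (hN : 0 < N) : 1 < meshRatio n N :=
  NNReal.one_lt_rpow (by exact_mod_cast hn) (by positivity)

theorem meshRatio_pow (hN : 0 < N) : meshRatio n N ^ N = n := by
  rw [meshRatio, ← NNReal.rpow_natCast, ← NNReal.rpow_mul, inv_mul_cancel₀ (by positivity),
    NNReal.rpow_one]

theorem coe_meshRatio (hn : 2 ≤ n) : (meshRatio n N : ℝ) = Real.exp (Real.log n / N) := by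
  rw [meshRatio, NNReal.coe_rpow, NNReal.coe_natCast, Real.rpow_def_of_pos (by positivity),
    div_eq_mul_inv]

theorem tendsto_meshRatio (hn : 2 ≤ n) :
    Tendsto (fun N ↦ (meshRatio n N : ℝ)) atTop (𝓝 1) := by
  simp_rw [coe_meshRatio hn]
  rw [← Real.exp_zero]
  exact (Real.continuous_exp.tendsto 0).comp (tendsto_const_div_atTop_nhds_zero_nat _)

theorem tendsto_mesh (hn : 2 ≤ n) :
    Tendsto (fun N ↦ 1 - (meshRatio n N : ℝ)⁻¹) atTop (𝓝 0) := by
  simpa using ((tendsto_meshRatio hn).inv₀ one_ne_zero).const_sub 1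

theorem tendsto_nat_mul_mesh (hn : 2 ≤ n) :
    Tendsto (fun N : ℕ ↦ (N : ℝ) * (1 - (meshRatio n N : ℝ)⁻¹)) atTop (𝓝 (Real.log n)) := by
  have h1 : Tendsto (fun N ↦ Real.log n * (meshRatio n N : ℝ)⁻¹) atTop (𝓝 (Real.log n)) := by
    simpa using ((tendsto_meshRatio hn).inv₀ one_ne_zero).const_mul (Real.log n)
  refine tendsto_of_tendsto_of_tendsto_of_le_of_le' h1 tendsto_const_nhds ?_ ?_
  all_goals
    filter_upwards [eventually_gt_atTop 0] with N hN
    have hN' : (0 : ℝ) < N := by positivity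
    have e : Real.log n = N * (Real.log n / N) := by field_simp
    rw [coe_meshRatio hn, ← Real.exp_neg]
    generalize Real.log n / N = y at *
    rw [e]
  · rw [mul_assoc]
    refine mul_le_mul_of_nonneg_left ?_ hN'.le
    have h2 := mul_le_mul_of_nonneg_right (Real.add_one_le_exp y) (Real.exp_pos (-y)).le
    rw [← Real.exp_add, add_neg_cancel, Real.exp_zero] at h2
    linarith
  · exact mul_le_mul_of_nonneg_left (by linarith [Real.add_one_le_exp (-y)]) hN'.le

end Mesh

theorem integral_inv_sq_of_pos {a b : ℝ} (ha : 0 < a) (hab : a ≤ b) :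
    ∫ t in a..b, (t ^ 2)⁻¹ = a⁻¹ - b⁻¹ := by
  have hpos : ∀ t ∈ Set.uIcc a b, t ≠ 0 := fun t ht ↦ by
    rw [Set.uIcc_of_le hab] at ht
    exact (ha.trans_le ht.1).ne'
  rw [intervalIntegral.integral_eq_sub_of_hasDerivAt (f := fun t ↦ -t⁻¹)]
  · ring
  · intro t ht
    simpa only [neg_neg] using (hasDerivAt_inv (hpos t ht)).fun_neg
  · exact ContinuousOn.intervalIntegrable ((continuousOn_pow 2).inv₀ fun t ht ↦
      pow_ne_zero 2 (hpos t ht))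

theorem abs_integral_div_sq_sub_le {g : ℝ → ℝ} (hg : Continuous g) {a b ε : ℝ} (ha : 0 < a)
    (hab : a ≤ b) (hε : ∀ t ∈ Set.Icc a b, |g t - g a| ≤ ε) :
    |g a * (a⁻¹ - b⁻¹) - ∫ t in a..b, g t / t ^ 2| ≤ ε * (a⁻¹ - b⁻¹) := by
  have hpos : ∀ t ∈ Set.uIcc a b, t ≠ 0 := fun t ht ↦ by
    rw [Set.uIcc_of_le hab] at ht
    exact (ha.trans_le ht.1).ne'
  have hi : ContinuousOn (fun t : ℝ ↦ (t ^ 2)⁻¹) (Set.uIcc a b) :=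
    (continuousOn_pow 2).inv₀ fun t ht ↦ pow_ne_zero 2 (hpos t ht)
  have hi' : ContinuousOn (fun t ↦ g t / t ^ 2) (Set.uIcc a b) :=
    hg.continuousOn.div (continuousOn_pow 2) fun t ht ↦ pow_ne_zero 2 (hpos t ht)
  rw [← integral_inv_sq_of_pos ha hab, ← intervalIntegral.integral_const_mul,
    ← intervalIntegral.integral_sub (continuousOn_const.fun_mul hi).intervalIntegrable
      hi'.intervalIntegrable, ← intervalIntegral.integral_const_mul,
    ← Real.norm_eq_abs]
  refine intervalIntegral.norm_integral_le_of_norm_le hab (ae_of_all _ fun t ht ↦ ?_)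
    (continuousOn_const.fun_mul hi).intervalIntegrable
  have : g a * (t ^ 2)⁻¹ - g t / t ^ 2 = (g a - g t) * (t ^ 2)⁻¹ := by ring
  rw [this, norm_mul, Real.norm_eq_abs, abs_sub_comm, Real.norm_of_nonneg (by positivity)]
  exact mul_le_mul_of_nonneg_right (hε t ⟨ht.1.le, ht.2⟩) (by positivity)

/-- The weight `(1 - q⁻¹) / q ^ k` is exactly the integral of `1 / t²` over the `k`-th cell, so the
only error is the oscillation of `g`, controlled by uniform continuity on `[1, n]`. -/
theorem tendsto_geometric_riemann_sum {g : ℝ → ℝ} (hg : Continuous g) {n : ℕ} (hn : 2 ≤ n) :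
    Tendsto (fun N ↦ (1 - (meshRatio n N : ℝ)⁻¹) *
      ∑ k ∈ Finset.range N, g ((meshRatio n N : ℝ) ^ k) / (meshRatio n N : ℝ) ^ k)
      atTop (𝓝 (∫ t in (1 : ℝ)..n, g t / t ^ 2)) := by
  have hn0 : (0 : ℝ) < n := by positivity
  rw [Metric.tendsto_atTop']
  intro ε hε
  have huc := isCompact_Icc.uniformContinuousOn_of_continuous (s := Set.Icc (1 : ℝ) n)
    hg.continuousOn
  rw [Metric.uniformContinuousOn_iff] at huc
  obtain ⟨δ, hδ, huc⟩ := huc ε hε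
  have hev : ∀ᶠ N in atTop, (meshRatio n N : ℝ) < 1 + δ / n :=
    (tendsto_meshRatio hn).eventually_lt_const (by linarith [div_pos hδ hn0])
  obtain ⟨N₀, hN₀⟩ := eventually_atTop.1 hev
  refine ⟨N₀, fun N hN ↦ ?_⟩
  have hN0 : 0 < N := by omega
  have hqδ := hN₀ N hN.le
  have hq1 : (1 : ℝ) < meshRatio n N := by exact_mod_cast one_lt_meshRatio hn hN0
  have hqN : (meshRatio n N : ℝ) ^ N = n := by exact_mod_cast meshRatio_pow (n := n) hN0
  generalize (meshRatio n N : ℝ) = q at *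
  have hq0 : 0 < q := by linarith
  have hint : ∀ k < N, IntervalIntegrable (fun t ↦ g t / t ^ 2) volume (q ^ k) (q ^ (k + 1)) := by
    intro k _
    refine ContinuousOn.intervalIntegrable (hg.continuousOn.div (continuousOn_pow 2) fun t ht ↦ ?_)
    rw [Set.uIcc_of_le (pow_le_pow_right₀ hq1.le k.le_succ)] at ht
    have : 0 < t := lt_of_lt_of_le (by positivity) ht.1
    positivity
  have hsum := intervalIntegral.sum_integral_adjacent_intervals hint
  rw [pow_zero, hqN] at hsum
  rw [Real.dist_eq, ← hsum, Finset.mul_sum, ← Finset.sum_sub_distrib]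
  have hk : ∀ k, (1 - q⁻¹) / q ^ k = (q ^ k)⁻¹ - (q ^ (k + 1))⁻¹ := by
    intro k
    rw [pow_succ]
    field_simp
  calc _ ≤ ∑ k ∈ Finset.range N, |(1 - q⁻¹) * (g (q ^ k) / q ^ k) -
          ∫ t in q ^ k..q ^ (k + 1), g t / t ^ 2| := Finset.abs_sum_le_sum_abs _ _
    _ ≤ ∑ k ∈ Finset.range N, ε * ((q ^ k)⁻¹ - (q ^ (k + 1))⁻¹) := by
      refine Finset.sum_le_sum fun k hkN ↦ ?_
      have hkN' : k + 1 ≤ N := Finset.mem_range.1 hkN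
      have h1 : 1 ≤ q ^ k := one_le_pow₀ hq1.le
      have h2 : q ^ (k + 1) ≤ n := hqN ▸ pow_le_pow_right₀ hq1.le hkN'
      have h3 : q ^ k ≤ q ^ (k + 1) := pow_le_pow_right₀ hq1.le k.le_succ
      have h4 : q ^ (k + 1) - q ^ k < δ := by
        have h5 : q - 1 < δ / n := by linarith
        have h6 : q ^ k * (q - 1) ≤ n * (q - 1) :=
          mul_le_mul_of_nonneg_right (h3.trans h2) (by linarith)
        have h7 : n * (q - 1) < n * (δ / n) := mul_lt_mul_of_pos_left h5 hn0
        rw [mul_div_cancel₀ _ hn0.ne'] at h7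
        rw [pow_succ]
        linarith
      have e : (1 - q⁻¹) * (g (q ^ k) / q ^ k) = g (q ^ k) * ((q ^ k)⁻¹ - (q ^ (k + 1))⁻¹) := by
        rw [← hk]
        ring
      rw [e]
      refine abs_integral_div_sq_sub_le hg (by positivity) h3 fun t ht ↦ ?_
      rw [← Real.dist_eq]
      refine (huc t ⟨h1.trans ht.1, ht.2.trans h2⟩ _ ⟨h1, h3.trans h2⟩ ?_).le
      rw [Real.dist_eq, abs_of_nonneg (by linarith [ht.1])]
      linarith [ht.2]
    _ = ε * (1 - (n : ℝ)⁻¹) := by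
      rw [← Finset.mul_sum, Finset.sum_range_sub' (fun k ↦ (q ^ k)⁻¹), hqN]
      simp
    _ < ε := mul_lt_of_lt_one_right hε (by linarith [inv_pos.2 hn0])

section Limits

variable {Ω : Type*} {mΩ : MeasurableSpace Ω} {P : Measure Ω}
  {f : ℕ → Ω → ℝ} {F : Ω → ℝ} {l : ℕ → ℝ} {L : ℝ}

theorem lintegral_exp_mul_le_of_tendsto (hf : ∀ N, AEMeasurable (f N) P)
    (hlim : ∀ᵐ ω ∂P, Tendsto (f · ω) atTop (𝓝 (F ω))) (hl : Tendsto l atTop (𝓝 L))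
    {u : ℕ → ℝ} {U : ℝ} (hu : Tendsto u atTop (𝓝 U))
    (h : ∀ᶠ N in atTop, ∫⁻ ω, ENNReal.ofReal (Real.exp (l N * f N ω)) ∂P ≤ ENNReal.ofReal (u N)) :
    ∫⁻ ω, ENNReal.ofReal (Real.exp (L * F ω)) ∂P ≤ ENNReal.ofReal U := by
  have hconv : ∀ᵐ ω ∂P, ENNReal.ofReal (Real.exp (L * F ω)) =
      liminf (fun N ↦ ENNReal.ofReal (Real.exp (l N * f N ω))) atTop := by
    filter_upwards [hlim] with ω hω
    refine (Tendsto.liminf_eq ?_).symm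
    exact ENNReal.tendsto_ofReal ((Real.continuous_exp.tendsto _).comp (hl.mul hω))
  calc _ = ∫⁻ ω, liminf (fun N ↦ ENNReal.ofReal (Real.exp (l N * f N ω))) atTop ∂P :=
        lintegral_congr_ae hconv
    _ ≤ liminf (fun N ↦ ∫⁻ ω, ENNReal.ofReal (Real.exp (l N * f N ω)) ∂P) atTop :=
        lintegral_liminf_le' fun N ↦ ((hf N).const_mul _).exp.ennreal_ofReal
    _ ≤ liminf (fun N ↦ ENNReal.ofReal (u N)) atTop := liminf_le_liminf h
    _ = _ := (ENNReal.tendsto_ofReal hu).liminf_eq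

theorem exp_mul_le_min_add {l l' δ R K y : ℝ} (hl : l ≤ l' - δ) (hδ : 0 ≤ δ)
    (hlK : l ≤ K) (hK : 0 ≤ K) (hy : 0 ≤ y) :
    Real.exp (l * y) ≤
      min (Real.exp (l * y)) (Real.exp (K * R)) + Real.exp (-(δ * R)) * Real.exp (l' * y) := by
  rcases le_total y R with h | h
  · rw [min_eq_left]
    · exact le_add_of_nonneg_right (by positivity)
    · exact Real.exp_le_exp.2 (by nlinarith)
  · refine le_trans ?_ (le_add_of_nonneg_left (by positivity))
    rw [← Real.exp_add]
    exact Real.exp_le_exp.2 (by nlinarith)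

/-- Fatou's lemma goes the wrong way here. A bounded moment at a larger exponent `L'` supplies
uniform integrability: truncate, pass to the limit by dominated convergence, then let the level `R`
tend to infinity. -/
theorem le_lintegral_exp_mul_of_tendsto [IsProbabilityMeasure P] (hf : ∀ N, AEMeasurable (f N) P)
    (hf0 : ∀ᶠ N in atTop, ∀ ω, 0 ≤ f N ω)
    (hlim : ∀ᵐ ω ∂P, Tendsto (f · ω) atTop (𝓝 (F ω))) (hl : Tendsto l atTop (𝓝 L))
    {u : ℕ → ℝ} {U : ℝ} (hu : Tendsto u atTop (𝓝 U))
    (h : ∀ᶠ N in atTop, ENNReal.ofReal (u N) ≤ ∫⁻ ω, ENNReal.ofReal (Real.exp (l N * f N ω)) ∂P)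
    {L' C : ℝ} (hL : L < L')
    (hC : ∀ᶠ N in atTop, ∫⁻ ω, ENNReal.ofReal (Real.exp (L' * f N ω)) ∂P ≤ ENNReal.ofReal C) :
    ENNReal.ofReal U ≤ ∫⁻ ω, ENNReal.ofReal (Real.exp (L * F ω)) ∂P := by
  set δ := (L' - L) / 2 with hδ
  have hδ0 : 0 < δ := by rw [hδ]; linarith
  have hl1 : ∀ᶠ N in atTop, l N ≤ L' - δ := hl.eventually_le_const (by rw [hδ]; linarith)
  have hl2 : ∀ᶠ N in atTop, l N ≤ |L| + 1 :=
    hl.eventually_le_const (by linarith [le_abs_self L])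
  have key : ∀ R : ℝ, ENNReal.ofReal U ≤
      ∫⁻ ω, ENNReal.ofReal (Real.exp (L * F ω)) ∂P +
        ENNReal.ofReal (Real.exp (-(δ * R))) * ENNReal.ofReal C := by
    intro R
    set K' := Real.exp ((|L| + 1) * R)
    have hdom : Tendsto (fun N ↦ ∫⁻ ω, ENNReal.ofReal (min (Real.exp (l N * f N ω)) K') ∂P) atTop
        (𝓝 (∫⁻ ω, ENNReal.ofReal (min (Real.exp (L * F ω)) K') ∂P)) := by
      refine tendsto_lintegral_of_dominated_convergence' (fun _ ↦ ENNReal.ofReal K')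
        (fun N ↦ (((hf N).const_mul _).exp.min aemeasurable_const).ennreal_ofReal)
        (fun N ↦ ae_of_all _ fun ω ↦ ENNReal.ofReal_le_ofReal (min_le_right _ _)) (by simp) ?_
      filter_upwards [hlim] with ω hω
      exact ENNReal.tendsto_ofReal
        (((Real.continuous_exp.tendsto _).comp (hl.mul hω)).min tendsto_const_nhds)
    have hle : ENNReal.ofReal U ≤ ∫⁻ ω, ENNReal.ofReal (min (Real.exp (L * F ω)) K') ∂P +
        ENNReal.ofReal (Real.exp (-(δ * R))) * ENNReal.ofReal C := by
      refine le_of_tendsto_of_tendsto (ENNReal.tendsto_ofReal hu) (hdom.add_const _) ?_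
      filter_upwards [h, hC, hl1, hl2, hf0] with N h hC hl1 hl2 hf0
      calc _ ≤ _ := h
        _ ≤ ∫⁻ ω, (ENNReal.ofReal (min (Real.exp (l N * f N ω)) K') +
              ENNReal.ofReal (Real.exp (-(δ * R))) *
                ENNReal.ofReal (Real.exp (L' * f N ω))) ∂P := by
            refine lintegral_mono fun ω ↦ ?_
            dsimp only
            rw [← ENNReal.ofReal_mul (by positivity), ← ENNReal.ofReal_add (by positivity)
              (by positivity)]
            exact ENNReal.ofReal_le_ofReal
              (exp_mul_le_min_add hl1 hδ0.le hl2 (by positivity) (hf0 ω))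
        _ = _ := lintegral_add_left'
            (((hf N).const_mul _).exp.min aemeasurable_const).ennreal_ofReal _
        _ ≤ _ := by
            rw [lintegral_const_mul' _ _ ENNReal.ofReal_ne_top]
            gcongr
    exact hle.trans (add_le_add_left (lintegral_mono fun ω ↦
      ENNReal.ofReal_le_ofReal (min_le_left _ _)) _)
  have hR : Tendsto (fun R : ℝ ↦ ∫⁻ ω, ENNReal.ofReal (Real.exp (L * F ω)) ∂P +
        ENNReal.ofReal (Real.exp (-(δ * R))) * ENNReal.ofReal C) atTop
      (𝓝 (∫⁻ ω, ENNReal.ofReal (Real.exp (L * F ω)) ∂P + ENNReal.ofReal 0 * ENNReal.ofReal C)) := by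
    refine Tendsto.const_add _ (ENNReal.Tendsto.mul_const (ENNReal.tendsto_ofReal ?_)
      (Or.inr ENNReal.ofReal_ne_top))
    exact Real.tendsto_exp_neg_atTop_nhds_zero.comp (tendsto_id.const_mul_atTop hδ0)
  rw [ENNReal.ofReal_zero, zero_mul, add_zero] at hR
  exact ge_of_tendsto' hR key

end Limits

end

/-! ### Bounds on the moment generating function of the functional. -/

section

variable {Ω : Type*} {mΩ : MeasurableSpace Ω} {P : Measure Ω} {B : ℝ≥0 → Ω → ℝ} {n : ℕ} {β : ℝ}

theorem ProbabilityTheory.IsBrownianReal.tendsto_geomSum (hB : IsBrownianReal B P) (hn : 2 ≤ n) :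
    ∀ᵐ ω ∂P, Tendsto (fun N ↦ geomSum B (meshRatio n N) N ω) atTop (𝓝 (brownianL B n ω)) := by
  filter_upwards [hB.cont] with ω hω
  have hg : Continuous fun t : ℝ ↦ B t.toNNReal ω ^ 2 := (hω.comp continuous_real_toNNReal).pow 2
  have h := tendsto_geometric_riemann_sum hg hn
  simp_rw [← NNReal.coe_pow, Real.toNNReal_coe, NNReal.coe_pow] at h
  exact h

theorem ProbabilityTheory.IsBrownianReal.aemeasurable_brownianL (hB : IsBrownianReal B P)
    (hn : 2 ≤ n) : AEMeasurable (brownianL B n) P :=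
  aemeasurable_of_tendsto_metrizable_ae atTop
    (fun N ↦ hB.toIsPreBrownianReal.aemeasurable_geomSum (meshRatio n N) N) (hB.tendsto_geomSum hn)

theorem tendsto_one_sub_mesh (hn : 2 ≤ n) (β : ℝ) :
    Tendsto (fun N ↦ 1 - 2 * (β * (1 - (meshRatio n N : ℝ)⁻¹))) atTop (𝓝 1) := by
  simpa using (((tendsto_mesh hn).const_mul β).const_mul 2).const_sub 1

theorem tendsto_div_one_sub_mesh (hn : 2 ≤ n) (β γ : ℝ) :
    Tendsto (fun N ↦ γ / (1 - 2 * (β * (1 - (meshRatio n N : ℝ)⁻¹)))) atTop (𝓝 γ) := by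
  simpa [div_eq_mul_inv] using ((tendsto_one_sub_mesh hn β).inv₀ one_ne_zero).const_mul γ

theorem ProbabilityTheory.IsBrownianReal.lintegral_exp_brownianL_le_of_nonneg
    (hB : IsBrownianReal B P) (hn : 2 ≤ n) (hβ : 0 ≤ β) (hβ' : β < 1 / 4) :
    ∫⁻ ω, ENNReal.ofReal (Real.exp (β * (1 - 2 * β) * brownianL B n ω)) ∂P ≤
      ENNReal.ofReal ((√(1 - 2 * β))⁻¹ * Real.exp (β * Real.log n)) := by
  refine lintegral_exp_mul_le_of_tendsto
    (fun N ↦ hB.toIsPreBrownianReal.aemeasurable_geomSum (meshRatio n N) N) (hB.tendsto_geomSum hn)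
    (tendsto_div_one_sub_mesh hn β _) (u := fun N ↦ (√(1 - 2 * β))⁻¹ * Real.exp
      (β / (1 - 2 * (β * (1 - (meshRatio n N : ℝ)⁻¹))) * (N * (1 - (meshRatio n N : ℝ)⁻¹)))) ?_ ?_
  · refine ((Real.continuous_exp.tendsto _).comp ?_).const_mul _
    exact (tendsto_div_one_sub_mesh hn β β).mul (tendsto_nat_mul_mesh hn)
  · filter_upwards [eventually_gt_atTop 0] with N hN
    exact hB.toIsPreBrownianReal.lintegral_exp_geomSum_le_of_nonneg (one_lt_meshRatio hn hN)
      rfl N hβ hβ'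

theorem ProbabilityTheory.IsBrownianReal.lintegral_exp_brownianL_le_of_nonpos
    (hB : IsBrownianReal B P) (hn : 2 ≤ n) (hβ : β ≤ 0) :
    ∫⁻ ω, ENNReal.ofReal (Real.exp (β * (1 - 2 * β) * brownianL B n ω)) ∂P ≤
      ENNReal.ofReal (Real.exp (β * (Real.log n - 1))) := by
  refine lintegral_exp_mul_le_of_tendsto
    (fun N ↦ hB.toIsPreBrownianReal.aemeasurable_geomSum (meshRatio n N) N) (hB.tendsto_geomSum hn)
    tendsto_const_nhds (u := fun N ↦ Real.exp (β / (1 - 2 * (β * (1 - (meshRatio n N : ℝ)⁻¹))) *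
      (N * (1 - (meshRatio n N : ℝ)⁻¹) - 1))) ?_ ?_
  · refine (Real.continuous_exp.tendsto _).comp ?_
    exact (tendsto_div_one_sub_mesh hn β β).mul ((tendsto_nat_mul_mesh hn).sub_const 1)
  · filter_upwards [eventually_gt_atTop 0] with N hN
    exact hB.toIsPreBrownianReal.lintegral_exp_geomSum_le_of_nonpos (one_lt_meshRatio hn hN)
      rfl N hβ

theorem ProbabilityTheory.IsBrownianReal.le_lintegral_exp_brownianL_of_neg
    (hB : IsBrownianReal B P) (hn : 2 ≤ n) (hβ : β < 0) :
    ENNReal.ofReal ((√(1 - 2 * β))⁻¹ * Real.exp (β * Real.log n)) ≤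
      ∫⁻ ω, ENNReal.ofReal (Real.exp (β * (1 - 2 * β) * brownianL B n ω)) ∂P := by
  have := hB.isGaussianProcess.isProbabilityMeasure
  -- The limiting exponent is negative, so `L' = 0` works and the auxiliary moment is the total
  -- mass.
  refine le_lintegral_exp_mul_of_tendsto
    (fun N ↦ hB.toIsPreBrownianReal.aemeasurable_geomSum (meshRatio n N) N) ?_
    (hB.tendsto_geomSum hn) (tendsto_div_one_sub_mesh hn β _)
    (((Real.continuous_exp.tendsto _).comp ((tendsto_nat_mul_mesh hn).const_mul β)).const_mul
      (√(1 - 2 * β))⁻¹) ?_ (L' := 0) (C := 1) (by nlinarith) (by simp)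
  all_goals filter_upwards [eventually_gt_atTop 0] with N hN
  · exact geomSum_nonneg (one_lt_meshRatio hn hN) N
  · exact hB.toIsPreBrownianReal.le_lintegral_exp_geomSum_of_nonpos (one_lt_meshRatio hn hN)
      rfl N hβ.le

theorem ProbabilityTheory.IsBrownianReal.le_lintegral_exp_brownianL_of_nonneg
    (hB : IsBrownianReal B P) (hn : 2 ≤ n) (hβ : 0 ≤ β) (hβ' : β < 1 / 4) :
    ENNReal.ofReal (Real.exp (β * Real.log n - β / (1 - 4 * β))) ≤
      ∫⁻ ω, ENNReal.ofReal (Real.exp (β * (1 - 2 * β) * brownianL B n ω)) ∂P := by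
  have := hB.isGaussianProcess.isProbabilityMeasure
  -- Since `β ↦ β(1 - 2β)` increases strictly up to `1/4`, this `γ` provides the larger exponent
  -- needed for uniform integrability.
  obtain ⟨γ, hγ, hγ'⟩ := exists_between hβ'
  have hγ0 : 0 < γ := hβ.trans_lt hγ
  have hbound : Tendsto (fun N : ℕ ↦ (√(1 - 2 * γ))⁻¹ * Real.exp
      (γ / (1 - 2 * (γ * (1 - (meshRatio n N : ℝ)⁻¹))) * (N * (1 - (meshRatio n N : ℝ)⁻¹))))
      atTop (𝓝 ((√(1 - 2 * γ))⁻¹ * Real.exp (γ * Real.log n))) :=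
    ((Real.continuous_exp.tendsto _).comp
      ((tendsto_div_one_sub_mesh hn γ γ).mul (tendsto_nat_mul_mesh hn))).const_mul _
  refine le_lintegral_exp_mul_of_tendsto
    (fun N ↦ hB.toIsPreBrownianReal.aemeasurable_geomSum (meshRatio n N) N) ?_
    (hB.tendsto_geomSum hn) (tendsto_div_one_sub_mesh hn β _)
    ((Real.continuous_exp.tendsto _).comp
      (((tendsto_nat_mul_mesh hn).const_mul β).sub_const (β / (1 - 4 * β))))
    ?_ (L' := γ * (1 - 2 * γ)) (C := (√(1 - 2 * γ))⁻¹ * Real.exp (γ * Real.log n) + 1)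
    (by nlinarith) ?_
  · filter_upwards [eventually_gt_atTop 0] with N hN
    exact geomSum_nonneg (one_lt_meshRatio hn hN) N
  · filter_upwards [eventually_gt_atTop 0] with N hN
    exact hB.toIsPreBrownianReal.le_lintegral_exp_geomSum_of_nonneg (one_lt_meshRatio hn hN)
      rfl N hβ hβ'
  · filter_upwards [eventually_gt_atTop 0, hbound.eventually_le_const (lt_add_one _)] with N hN hle
    have hq := one_lt_meshRatio hn hN
    obtain ⟨hs0, hs1⟩ := mesh_mem hq rfl
    refine le_trans (lintegral_mono fun ω ↦ ENNReal.ofReal_le_ofReal <| Real.exp_le_exp.2 <|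
      mul_le_mul_of_nonneg_right (le_div_self ?_ ?_ ?_) (geomSum_nonneg hq N ω))
      ((hB.toIsPreBrownianReal.lintegral_exp_geomSum_le_of_nonneg hq rfl N hγ0.le hγ').trans
        (ENNReal.ofReal_le_ofReal hle))
    all_goals nlinarith

/-- Up to multiplicative constants, the moment generating function of `brownianL B n` at
`β * (1 - 2 * β)` is `n ^ β`. -/
theorem ProbabilityTheory.IsBrownianReal.exists_mgf_brownianL_bounds
    (hB : IsBrownianReal B P) (hβ : β < 1 / 4) :
    ∃ C, ∀ n : ℕ, 2 ≤ n →
      Integrable (fun ω ↦ Real.exp (β * (1 - 2 * β) * brownianL B n ω)) P ∧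
      Real.exp (β * Real.log n - C) ≤ mgf (brownianL B n) P (β * (1 - 2 * β)) ∧
      mgf (brownianL B n) P (β * (1 - 2 * β)) ≤ Real.exp (β * Real.log n + C) := by
  obtain ⟨C, hC⟩ : ∃ C, ∀ n : ℕ, 2 ≤ n → ENNReal.ofReal (Real.exp (β * Real.log n - C)) ≤
        ∫⁻ ω, ENNReal.ofReal (Real.exp (β * (1 - 2 * β) * brownianL B n ω)) ∂P ∧
      ∫⁻ ω, ENNReal.ofReal (Real.exp (β * (1 - 2 * β) * brownianL B n ω)) ∂P ≤
        ENNReal.ofReal (Real.exp (β * Real.log n + C)) := by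
    have hpos : 0 < (√(1 - 2 * β))⁻¹ := inv_pos.2 (Real.sqrt_pos.2 (by linarith))
    rcases lt_or_ge β 0 with h | h
    · refine ⟨max (-β) (-Real.log (√(1 - 2 * β))⁻¹), fun n hn ↦ ⟨?_, ?_⟩⟩
      · refine le_trans (ENNReal.ofReal_le_ofReal ?_) (hB.le_lintegral_exp_brownianL_of_neg hn h)
        nth_rewrite 2 [← Real.exp_log hpos]
        rw [← Real.exp_add, Real.exp_le_exp]
        linarith [le_max_right (-β) (-Real.log (√(1 - 2 * β))⁻¹)]
      · refine (hB.lintegral_exp_brownianL_le_of_nonpos hn h.le).trans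
          (ENNReal.ofReal_le_ofReal (Real.exp_le_exp.2 ?_))
        linarith [le_max_left (-β) (-Real.log (√(1 - 2 * β))⁻¹)]
    · refine ⟨max (β / (1 - 4 * β)) (Real.log (√(1 - 2 * β))⁻¹), fun n hn ↦ ⟨?_, ?_⟩⟩
      · refine le_trans (ENNReal.ofReal_le_ofReal (Real.exp_le_exp.2 ?_))
          (hB.le_lintegral_exp_brownianL_of_nonneg hn h hβ)
        linarith [le_max_left (β / (1 - 4 * β)) (Real.log (√(1 - 2 * β))⁻¹)]
      · refine (hB.lintegral_exp_brownianL_le_of_nonneg hn h hβ).trans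
          (ENNReal.ofReal_le_ofReal ?_)
        nth_rewrite 1 [← Real.exp_log hpos]
        rw [← Real.exp_add, Real.exp_le_exp]
        linarith [le_max_right (β / (1 - 4 * β)) (Real.log (√(1 - 2 * β))⁻¹)]
  refine ⟨C, fun n hn ↦ ?_⟩
  obtain ⟨h1, h2⟩ := hC n hn
  have hm : AEStronglyMeasurable (fun ω ↦ Real.exp (β * (1 - 2 * β) * brownianL B n ω)) P :=
    ((hB.aemeasurable_brownianL hn).const_mul _).exp.aestronglyMeasurable
  have hnn : 0 ≤ᵐ[P] fun ω ↦ Real.exp (β * (1 - 2 * β) * brownianL B n ω) :=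
    ae_of_all _ fun ω ↦ (Real.exp_pos _).le
  have hint : Integrable (fun ω ↦ Real.exp (β * (1 - 2 * β) * brownianL B n ω)) P :=
    (lintegral_ofReal_ne_top_iff_integrable hm hnn).1 (h2.trans_lt ENNReal.ofReal_lt_top).ne
  rw [← ofReal_integral_eq_lintegral_ofReal hint hnn] at h1 h2
  exact ⟨hint, (ENNReal.ofReal_le_ofReal_iff mgf_nonneg).1 h1,
    (ENNReal.ofReal_le_ofReal_iff (Real.exp_pos _).le).1 h2⟩

end

/-! ### Legendre transform, Chernoff bounds and tilting. -/

section

/-- The exponential growth rate `(1 - 1 / c) / 4` of the moment generating function at the point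
under which `brownianL B n` is tilted to be of size `c * log n`. -/
noncomputable def tiltRate (c : ℝ) : ℝ := (1 - c⁻¹) / 4

/-- The point `(1 - 1 / c ^ 2) / 8` at which the Legendre transform of `tiltRate` is attained. -/
noncomputable def tiltPoint (c : ℝ) : ℝ := tiltRate c * (1 - 2 * tiltRate c)

section Rate

variable {c d : ℝ}

theorem tiltRate_lt (hc : 0 < c) : tiltRate c < 1 / 4 := by
  have := inv_pos.2 hc
  rw [tiltRate]
  linarith

theorem tiltPoint_eq (c : ℝ) : tiltPoint c = (1 - c⁻¹ ^ 2) / 8 := by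
  rw [tiltPoint, tiltRate]
  ring

theorem tiltRate_sub_tiltPoint_mul (hc : 0 < c) : tiltRate c - tiltPoint c * c = -rateK c := by
  rw [tiltPoint_eq, tiltRate, rateK]
  field_simp
  ring

theorem tiltPoint_lt (hc : 0 < c) (h : c < d) : tiltPoint c < tiltPoint d := by
  have h1 : d⁻¹ < c⁻¹ := (inv_lt_inv₀ (hc.trans h) hc).2 h
  have h2 := inv_pos.2 (hc.trans h)
  rw [tiltPoint_eq, tiltPoint_eq]
  nlinarith

/-- Strict convexity of the growth rate: its tangent at the point of slope `d` lies strictly below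
it at the point of slope `c`, with gap `d (1/c - 1/d)² / 8`. This makes the tails of the tilted
moment negligible. -/
theorem tiltRate_lt_of_lt (hc : 0 < c) (h : c ≠ d) (hd : 0 < d) :
    tiltRate d - (tiltPoint d - tiltPoint c) * d < tiltRate c := by
  rw [tiltPoint_eq, tiltPoint_eq, tiltRate, tiltRate]
  have h1 : (1 - d⁻¹) / 4 - ((1 - d⁻¹ ^ 2) / 8 - (1 - c⁻¹ ^ 2) / 8) * d =
      (1 - c⁻¹) / 4 - d / 8 * (c⁻¹ - d⁻¹) ^ 2 := by
    field_simp
    ring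
  have h2 : c⁻¹ - d⁻¹ ≠ 0 := sub_ne_zero.2 (inv_injective.ne h)
  have : 0 < d / 8 * (c⁻¹ - d⁻¹) ^ 2 := by positivity
  linarith

theorem exists_forall_neg_rateK_lt (hc : 0 < c) {ε : ℝ} (hε : 0 < ε) :
    ∃ δ > 0, ∀ c₀ c₁ c₂ : ℝ, |c₀ - c| < δ → |c₁ - c| < δ → |c₂ - c| < δ →
      -rateK c - ε < tiltRate c₁ - max (tiltPoint c₁ * c₀) (tiltPoint c₁ * c₂) := by
  have hr : ContinuousAt tiltRate c := by
    unfold tiltRate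
    fun_prop (disch := positivity)
  have hp : ContinuousAt tiltPoint c := hr.mul (continuousAt_const.sub (hr.const_mul 2))
  have hcont : ContinuousAt (fun p : ℝ × ℝ × ℝ ↦
      tiltRate p.2.1 - max (tiltPoint p.2.1 * p.1) (tiltPoint p.2.1 * p.2.2)) (c, c, c) := by
    have h1 : ContinuousAt (fun p : ℝ × ℝ × ℝ ↦ p.2.1) (c, c, c) := by fun_prop
    have hr' : ContinuousAt (fun p : ℝ × ℝ × ℝ ↦ tiltRate p.2.1) (c, c, c) :=
      ContinuousAt.comp (g := tiltRate) (f := fun p : ℝ × ℝ × ℝ ↦ p.2.1) hr h1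
    have hp' : ContinuousAt (fun p : ℝ × ℝ × ℝ ↦ tiltPoint p.2.1) (c, c, c) :=
      ContinuousAt.comp (g := tiltPoint) (f := fun p : ℝ × ℝ × ℝ ↦ p.2.1) hp h1
    exact hr'.sub ((hp'.mul continuousAt_fst).max (hp'.mul (by fun_prop)))
  have hlt : -rateK c - ε < tiltRate c - max (tiltPoint c * c) (tiltPoint c * c) := by
    rw [max_self, tiltRate_sub_tiltPoint_mul hc]
    linarith
  obtain ⟨δ, hδ, h⟩ := Metric.eventually_nhds_iff.1 (hcont.eventually_const_lt hlt)
  refine ⟨δ, hδ, fun c₀ c₁ c₂ h0 h1 h2 ↦ h (y := (c₀, c₁, c₂)) ?_⟩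
  simp only [Prod.dist_eq, Real.dist_eq]
  exact max_lt h0 (max_lt h1 h2)

end Rate

theorem tendsto_log_natCast_atTop : Tendsto (fun n : ℕ ↦ Real.log n) atTop atTop :=
  Real.tendsto_log_atTop.comp tendsto_natCast_atTop_atTop

theorem eventually_exp_mul_log_le {a b : ℝ} (h : a < b) (C : ℝ) :
    ∀ᶠ n : ℕ in atTop, Real.exp (a * Real.log n + C) ≤ Real.exp (b * Real.log n) := by
  filter_upwards [tendsto_log_natCast_atTop.eventually_ge_atTop (C / (b - a))] with n hn
  rw [div_le_iff₀ (by linarith)] at hn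
  exact Real.exp_le_exp.2 (by linarith)

theorem exists_rpow_neg_add_of_log_asymptotics {p : ℕ → ℝ} {K : ℝ}
    (hlow : ∀ ε > 0, ∀ᶠ n : ℕ in atTop, Real.exp ((-K - ε) * Real.log n) ≤ p n)
    (hup : ∀ ε > 0, ∀ᶠ n : ℕ in atTop, p n ≤ Real.exp ((-K + ε) * Real.log n)) :
    ∃ ε : ℕ → ℝ, Tendsto ε atTop (𝓝 0) ∧ ∀ᶠ n : ℕ in atTop, p n = (n : ℝ) ^ (-K + ε n) := by
  refine ⟨fun n ↦ Real.log (p n) / Real.log n + K, ?_, ?_⟩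
  · rw [Metric.tendsto_nhds]
    intro ε hε
    filter_upwards [hlow (ε / 2) (by linarith), hup (ε / 2) (by linarith),
      tendsto_log_natCast_atTop.eventually_gt_atTop 0] with n h1 h2 h3
    have hp : 0 < p n := (Real.exp_pos _).trans_le h1
    rw [← Real.le_log_iff_exp_le hp, ← le_div_iff₀ h3] at h1
    rw [← Real.log_le_iff_le_exp hp, ← div_le_iff₀ h3] at h2
    rw [Real.dist_eq, sub_zero, abs_lt]
    constructor <;> linarith
  · filter_upwards [hlow 1 one_pos, tendsto_log_natCast_atTop.eventually_gt_atTop 0,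
      eventually_gt_atTop 0] with n h1 h3 hn
    have hp : 0 < p n := (Real.exp_pos _).trans_le h1
    rw [Real.rpow_def_of_pos (by positivity), neg_add_cancel_comm_assoc,
      mul_div_cancel₀ _ h3.ne', Real.exp_log hp]

variable {Ω : Type*} {mΩ : MeasurableSpace Ω} {P : Measure Ω} {B : ℝ≥0 → Ω → ℝ} {c c₀ c₁ c₂ ε : ℝ}

theorem ProbabilityTheory.IsBrownianReal.eventually_measureReal_le (hB : IsBrownianReal B P)
    (hc : 0 < c) (hc1 : c ≤ 1) (hε : 0 < ε) :
    ∀ᶠ n : ℕ in atTop, P.real {ω | brownianL B n ω ≤ c * Real.log n} ≤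
      Real.exp ((-rateK c + ε) * Real.log n) := by
  have := hB.isGaussianProcess.isProbabilityMeasure
  obtain ⟨C, hC⟩ := hB.exists_mgf_brownianL_bounds (tiltRate_lt hc)
  have h0 : tiltPoint c ≤ 0 := by
    have := (one_le_inv₀ hc).2 hc1
    rw [tiltPoint_eq]
    nlinarith
  filter_upwards [eventually_exp_mul_log_le (lt_add_of_pos_right (-rateK c) hε) C,
    eventually_ge_atTop 2] with n h1 hn
  refine le_trans ?_ h1
  obtain ⟨hi, -, hu⟩ := hC n hn
  refine (measure_le_le_exp_mul_mgf _ h0 hi).trans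
    ((mul_le_mul_of_nonneg_left hu (Real.exp_pos _).le).trans (le_of_eq ?_))
  rw [← Real.exp_add, ← tiltRate_sub_tiltPoint_mul hc]
  congr 1
  ring

theorem ProbabilityTheory.IsBrownianReal.eventually_measureReal_ge (hB : IsBrownianReal B P)
    (hc1 : 1 ≤ c) (hε : 0 < ε) :
    ∀ᶠ n : ℕ in atTop, P.real {ω | c * Real.log n ≤ brownianL B n ω} ≤
      Real.exp ((-rateK c + ε) * Real.log n) := by
  have := hB.isGaussianProcess.isProbabilityMeasure
  have hc : 0 < c := by linarith
  obtain ⟨C, hC⟩ := hB.exists_mgf_brownianL_bounds (tiltRate_lt hc)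
  have h0 : 0 ≤ tiltPoint c := by
    have h1 := inv_le_one_of_one_le₀ hc1
    have h2 := inv_pos.2 hc
    rw [tiltPoint_eq]
    nlinarith
  filter_upwards [eventually_exp_mul_log_le (lt_add_of_pos_right (-rateK c) hε) C,
    eventually_ge_atTop 2] with n h1 hn
  refine le_trans ?_ h1
  obtain ⟨hi, -, hu⟩ := hC n hn
  refine (measure_ge_le_exp_mul_mgf _ h0 hi).trans
    ((mul_le_mul_of_nonneg_left hu (Real.exp_pos _).le).trans (le_of_eq ?_))
  rw [← Real.exp_add, ← tiltRate_sub_tiltPoint_mul hc]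
  congr 1
  ring

theorem exp_mul_le_indicator_add {l l₀ l₂ a b y : ℝ} (h0 : l₀ ≤ l) (h2 : l ≤ l₂) :
    Real.exp (l * y) ≤ (Set.Icc a b).indicator (fun _ ↦ Real.exp (max (l * a) (l * b))) y +
      Real.exp (-((l₂ - l) * b)) * Real.exp (l₂ * y) +
      Real.exp ((l - l₀) * a) * Real.exp (l₀ * y) := by
  have h3 : 0 ≤ (Set.Icc a b).indicator (fun _ ↦ Real.exp (max (l * a) (l * b))) y :=
    Set.indicator_nonneg (fun _ _ ↦ (Real.exp_pos _).le) y
  rw [← Real.exp_add, ← Real.exp_add]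
  have e1 := Real.exp_pos (-((l₂ - l) * b) + l₂ * y)
  have e2 := Real.exp_pos ((l - l₀) * a + l₀ * y)
  rcases lt_or_ge y a with ha | ha
  · have : Real.exp (l * y) ≤ Real.exp ((l - l₀) * a + l₀ * y) := Real.exp_le_exp.2 (by nlinarith)
    linarith
  rcases lt_or_ge b y with hb | hb
  · have : Real.exp (l * y) ≤ Real.exp (-((l₂ - l) * b) + l₂ * y) :=
      Real.exp_le_exp.2 (by nlinarith)
    linarith
  have : Real.exp (l * y) ≤ Real.exp (max (l * a) (l * b)) := by
    refine Real.exp_le_exp.2 (le_max_iff.2 ?_)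
    rcases le_total 0 l with h | h
    · exact Or.inr (mul_le_mul_of_nonneg_left hb h)
    · exact Or.inl (mul_le_mul_of_nonpos_left ha h)
  rw [Set.indicator_of_mem (Set.mem_Icc.2 ⟨ha, hb⟩)]
  linarith

/-- A substitute for a change of measure: the part of the moment at `l` outside `[a, b]` is bounded
in Chernoff's manner, passing to `l₂` above `b` and to `l₀` below `a`. -/
theorem mgf_le_measureReal_add [IsProbabilityMeasure P] {Y : Ω → ℝ} (hY : AEMeasurable Y P)
    {l l₀ l₂ a b : ℝ} (h0 : l₀ ≤ l) (h2 : l ≤ l₂)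
    (hi : Integrable (fun ω ↦ Real.exp (l * Y ω)) P)
    (hi0 : Integrable (fun ω ↦ Real.exp (l₀ * Y ω)) P)
    (hi2 : Integrable (fun ω ↦ Real.exp (l₂ * Y ω)) P) :
    mgf Y P l ≤ P.real (Y ⁻¹' Set.Icc a b) * Real.exp (max (l * a) (l * b)) +
      Real.exp (-((l₂ - l) * b)) * mgf Y P l₂ + Real.exp ((l - l₀) * a) * mgf Y P l₀ := by
  have hA : NullMeasurableSet (Y ⁻¹' Set.Icc a b) P := hY.nullMeasurable measurableSet_Icc
  have hiA : Integrable
      ((Y ⁻¹' Set.Icc a b).indicator fun _ ↦ Real.exp (max (l * a) (l * b))) P :=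
    (integrable_const _).indicator₀ hA
  have hiA2 : Integrable (fun ω ↦
      (Y ⁻¹' Set.Icc a b).indicator (fun _ ↦ Real.exp (max (l * a) (l * b))) ω +
        Real.exp (-((l₂ - l) * b)) * Real.exp (l₂ * Y ω)) P := hiA.add (hi2.const_mul _)
  calc mgf Y P l ≤ ∫ ω, ((Y ⁻¹' Set.Icc a b).indicator (fun _ ↦ Real.exp (max (l * a) (l * b))) ω +
          Real.exp (-((l₂ - l) * b)) * Real.exp (l₂ * Y ω) +
          Real.exp ((l - l₀) * a) * Real.exp (l₀ * Y ω)) ∂P :=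
        integral_mono hi (hiA2.add (hi0.const_mul _))
          fun ω ↦ exp_mul_le_indicator_add h0 h2
    _ = _ := by
        rw [integral_add hiA2 (hi0.const_mul _),
          integral_add hiA (hi2.const_mul _), integral_const_mul, integral_const_mul,
          integral_indicator₀ hA, setIntegral_const, smul_eq_mul]
        rfl

theorem ProbabilityTheory.IsBrownianReal.eventually_le_measureReal_Icc (hB : IsBrownianReal B P)
    (h0 : 0 < c₀) (h01 : c₀ < c₁) (h12 : c₁ < c₂) {a : ℝ}
    (ha : a < tiltRate c₁ - max (tiltPoint c₁ * c₀) (tiltPoint c₁ * c₂)) :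
    ∀ᶠ n : ℕ in atTop, Real.exp (a * Real.log n) ≤
      P.real (brownianL B n ⁻¹' Set.Icc (c₀ * Real.log n) (c₂ * Real.log n)) := by
  have := hB.isGaussianProcess.isProbabilityMeasure
  have hc1 := h0.trans h01
  have hc2 := hc1.trans h12
  obtain ⟨C₀, hC₀⟩ := hB.exists_mgf_brownianL_bounds (tiltRate_lt h0)
  obtain ⟨C₁, hC₁⟩ := hB.exists_mgf_brownianL_bounds (tiltRate_lt hc1)
  obtain ⟨C₂, hC₂⟩ := hB.exists_mgf_brownianL_bounds (tiltRate_lt hc2)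
  -- The constants `log 4` make each tail at most a quarter of the lower bound for the moment at
  -- `c₁`. Half of it is left for the window, which accounts for `log 2`.
  filter_upwards [eventually_ge_atTop 2,
    eventually_exp_mul_log_le (tiltRate_lt_of_lt hc1 h01.ne' h0) (C₀ + C₁ + Real.log 4),
    eventually_exp_mul_log_le (tiltRate_lt_of_lt hc1 h12.ne hc2) (C₂ + C₁ + Real.log 4),
    eventually_exp_mul_log_le ha (C₁ + Real.log 2),
    tendsto_log_natCast_atTop.eventually_ge_atTop 0] with n hn e0 e2 ea hT
  obtain ⟨hi0, -, hu0⟩ := hC₀ n hn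
  obtain ⟨hi1, hl1, -⟩ := hC₁ n hn
  obtain ⟨hi2, -, hu2⟩ := hC₂ n hn
  have key := mgf_le_measureReal_add (hB.aemeasurable_brownianL hn)
    (a := c₀ * Real.log n) (b := c₂ * Real.log n)
    (tiltPoint_lt h0 h01).le (tiltPoint_lt hc1 h12).le hi1 hi0 hi2
  rw [← mul_assoc, ← mul_assoc, ← max_mul_of_nonneg _ _ hT] at key
  set T := Real.log n
  set p := P.real (brownianL B n ⁻¹' Set.Icc (c₀ * T) (c₂ * T))
  set m := max (tiltPoint c₁ * c₀) (tiltPoint c₁ * c₂)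
  have hE := Real.exp_pos (tiltRate c₁ * T - C₁)
  have b0 : Real.exp ((tiltPoint c₁ - tiltPoint c₀) * (c₀ * T)) *
      mgf (brownianL B n) P (tiltPoint c₀) ≤ Real.exp (tiltRate c₁ * T - C₁) / 4 := by
    refine (mul_le_mul_of_nonneg_left hu0 (Real.exp_pos _).le).trans ?_
    rw [← Real.exp_log (show (0 : ℝ) < 4 by norm_num), ← Real.exp_add, ← Real.exp_sub,
      Real.exp_le_exp]
    rw [Real.exp_le_exp] at e0
    linarith
  have b2 : Real.exp (-((tiltPoint c₂ - tiltPoint c₁) * (c₂ * T))) *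
      mgf (brownianL B n) P (tiltPoint c₂) ≤ Real.exp (tiltRate c₁ * T - C₁) / 4 := by
    refine (mul_le_mul_of_nonneg_left hu2 (Real.exp_pos _).le).trans ?_
    rw [← Real.exp_log (show (0 : ℝ) < 4 by norm_num), ← Real.exp_add, ← Real.exp_sub,
      Real.exp_le_exp]
    rw [Real.exp_le_exp] at e2
    linarith
  have hp : Real.exp (tiltRate c₁ * T - C₁) / 2 ≤ p * Real.exp (m * T) := by
    have := hl1.trans key
    unfold tiltPoint at *
    linarith
  rw [← div_le_iff₀ (Real.exp_pos _)] at hp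
  refine le_trans ?_ hp
  rw [← Real.exp_log (show (0 : ℝ) < 2 by norm_num), ← Real.exp_sub, ← Real.exp_sub,
    Real.exp_le_exp]
  rw [Real.exp_le_exp] at ea
  linarith

end

/-! ### The two tail asymptotics. -/

theorem theorem8p2 {Ω : Type*} [MeasurableSpace Ω] (P : Measure Ω) (B : ℝ≥0 → Ω → ℝ)
    (hB : IsBrownianReal B P) :
    (∀ c : ℝ, 0 < c → c ≤ 1 →
      ∃ ε : ℕ → ℝ, Tendsto ε atTop (𝓝 0) ∧
        ∀ᶠ n : ℕ in atTop,
          P.real {ω | brownianL B n ω ≤ c * Real.log n} = (n : ℝ) ^ (-rateK c + ε n)) ∧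
    (∀ c : ℝ, 1 ≤ c →
      ∃ ε : ℕ → ℝ, Tendsto ε atTop (𝓝 0) ∧
        ∀ᶠ n : ℕ in atTop,
          P.real {ω | c * Real.log n ≤ brownianL B n ω} = (n : ℝ) ^ (-rateK c + ε n)) := by
  have := hB.isGaussianProcess.isProbabilityMeasure
  refine ⟨fun c hc hc1 ↦ exists_rpow_neg_add_of_log_asymptotics (fun ε hε ↦ ?_)
    fun ε hε ↦ hB.eventually_measureReal_le hc hc1 hε,
    fun c hc1 ↦ exists_rpow_neg_add_of_log_asymptotics (fun ε hε ↦ ?_)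
    fun ε hε ↦ hB.eventually_measureReal_ge hc1 hε⟩
  · obtain ⟨δ, hδ, h⟩ := exists_forall_neg_rateK_lt hc hε
    obtain ⟨η, hη, hη'⟩ := exists_between (lt_min (half_pos hδ) (half_pos hc))
    rw [lt_min_iff] at hη'
    -- The window `[c - 2η, c]` lies inside the event and the tilt aims at its interior point `c -
    -- η`; `η < c / 2` keeps the window positive. The second part mirrors this above `c`.
    have ha := h (c - 2 * η) (c - η) c (by rw [abs_lt]; constructor <;> linarith)
      (by rw [abs_lt]; constructor <;> linarith) (by simpa using hδ)
    filter_upwards [hB.eventually_le_measureReal_Icc (by linarith) (by linarith) (by linarith) ha]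
      with n hn
    exact hn.trans (measureReal_mono fun ω hω ↦ hω.2)
  · have hc : 0 < c := by linarith
    obtain ⟨δ, hδ, h⟩ := exists_forall_neg_rateK_lt hc hε
    have ha := h c (c + δ / 4) (c + δ / 2) (by simpa using hδ)
      (by rw [abs_lt]; constructor <;> linarith) (by rw [abs_lt]; constructor <;> linarith)
    filter_upwards [hB.eventually_le_measureReal_Icc hc (by linarith) (by linarith) ha] with n hn
    exact hn.trans (measureReal_mono fun ω hω ↦ hω.1)
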